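/- **Setting.** Let $d\in\mathbb N$ and $0<\Psi_{low}\le\Psi_{high}<\infty$. For every sample size $n$ let $X_1,\dots,X_n$ be fixed covariate vectors in a compact set $K\subset\mathbb R^d$ (not depending on $n$) and $Y_i=f_0(X_i)+\epsilon_i$, $i=1,\dots,n$, where $f_0$ is continuous on $K$ and $\epsilon_i=\epsilon(s_i)$ are the values of a mean-zero Gaussian process $\epsilon(\cdot)$ at locations $s_1,\dots,s_n$ (covariates and locations may depend on $n$). Write $\|f\|_n=\big(\frac1n\sum_{i=1}^n f(X_i)^2\big)^{1/2}$. **Assumption 1.** For all $n$, all eigenvalues of $\Sigma=\Sigma_n=\mathrm{Cov}(Y_1,\dots,Y_n)$ lie in $[\Psi_{low},\Psi_{high}]$. **Assumption 2.** Let $\sigma:\mathbb R\to[-r_b,r_b]$ be a sigmoidal activation function, i.e. nondecreasing, and Lipschitz with constant $L_{lip}>0$. The mean is modelled in $$\mathcal F_n=\Big\{x\mapsto\alpha_0+\sum_{j=1}^{r_n}\alpha_j\,\sigma(\gamma_j^\top x+\gamma_{0,j}) :\ \sum_{j=0}^{r_n}|\alpha_j|\le V_n,\ \max_{1\le j\le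 r_n}\sum_{i=0}^d|\gamma_{i,j}|\le M_n\Big\},$$ with $V_n>1/L_{lip}$, $M_n>0$, where $r_n,V_n,M_n\to\infty$ and $r_nV_n^2\log(V_nr_n)=o(n)$. **Assumption 3.** For each $n$, $Q=Q_n$ is a (deterministic) symmetric positive definite working precision matrix and, for all $n$, all eigenvalues of the discrepancy matrix $E=\Sigma^{\top/2}Q\,\Sigma^{1/2}$ (where $\Sigma=\Sigma^{1/2}\Sigma^{\top/2}$) lie in $[\Lambda_{low},\Lambda_{high}]$, with constants $0<\Lambda_{low}\le1\le\Lambda_{high}<\infty$ not depending on $n$. Let $\pi_{r_n}f_0\in\mathcal F_n$ be a projection of $f_0$ onto $\mathcal F_n$ with respect to $\|\cdot\|_n$, i.e. a minimizer of $\|f-f_0\|_n$ over $f\in\mathcal F_n$, and let the NN-GLS estimator $\hat f_n$ be, almost surely, a minimizer over $f\in\mathcal F_n$ of the GLS loss $$\mathcal L_n(f)=\tfrac1n\,(\mathbf Y-\mathbf f(\mathbf X))^\top Q\,(\mathbf Y-\mathbf f(\mathbf X)).$$ **Theorem (Convergence rate).** Under these assumptions, $$\|\hat f_n-f_0\|_n=O_p\Big(\frac{\Lambda_{high}}{\Lambda_{low}}\|\pi_{r_n}f_0-f_0\|_n\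 \vee\ \frac{\Lambda_{high}}{\Lambda_{low}}\sqrt{\frac{r_n\log n}{n}}\Big),$$ where the constant in $O_p$ does not depend on $\Lambda_{low},\Lambda_{high}$ or $Q$. Precisely: for every $\eta>0$ there is a constant $C>0$, depending only on $\eta,d,\Psi_{low},\Psi_{high}$, such that in every setting as above there is $N$ with, for all $n\ge N$, $$P\Big(\|\hat f_n-f_0\|_n> C\max\Big\{\frac{\Lambda_{high}}{\Lambda_{low}}\|\pi_{r_n}f_0-f_0\|_n,\ \frac{\Lambda_{high}}{\Lambda_{low}}\sqrt{\frac{r_n\log n}{n}}\Big\}\Big)\le\eta .$$ -/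

import Mathlib

open MeasureTheory ProbabilityTheory Filter Matrix
open scoped Asymptotics NNReal ENNReal

namespace NNGLS

noncomputable section

/-- Covariate vectors in `ℝ^d`. -/
abbrev Cov (d : ℕ) := EuclideanSpace ℝ (Fin d)

/-- The empirical norm `‖f‖ₙ = ((1/n) ∑ᵢ f(Xᵢ)²)^{1/2}` at the covariates `X₁, …, Xₙ`. -/
def empNorm {d n : ℕ} (X : Fin n → Cov d) (f : Cov d → ℝ) : ℝ :=
  √((1 / (n : ℝ)) * ∑ i, f (X i) ^ 2)

/-- One-hidden-layer networks `x ↦ α₀ + ∑_{j ≤ r} αⱼ σ(γⱼᵀ x + γ₀ⱼ)` with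
`∑_{j=0}^r |αⱼ| ≤ V` and `max_j ∑_{i=0}^d |γᵢⱼ| ≤ M`. -/
def sieve (d : ℕ) (σ : ℝ → ℝ) (r : ℕ) (V M : ℝ) : Set (Cov d → ℝ) :=
  {f | ∃ (α₀ : ℝ) (α : Fin r → ℝ) (γ₀ : Fin r → ℝ) (γ : Fin r → Cov d),
    |α₀| + ∑ j, |α j| ≤ V ∧
    (∀ j, |γ₀ j| + ∑ i, |γ j i| ≤ M) ∧
    f = fun x => α₀ + ∑ j, α j * σ ((∑ i, γ j i * x i) + γ₀ j)}

/-- The GLS loss `(1/n) (y - f(X))ᵀ Q (y - f(X))`. -/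
def glsLoss {d n : ℕ} (X : Fin n → Cov d) (Q : Matrix (Fin n) (Fin n) ℝ) (y : Fin n → ℝ)
    (f : Cov d → ℝ) : ℝ :=
  (1 / (n : ℝ)) * ((fun i => y i - f (X i)) ⬝ᵥ (Q *ᵥ fun i => y i - f (X i)))

/-- `f` minimizes the GLS loss over the class `F`. -/
def IsGLSEstimate {d n : ℕ} (X : Fin n → Cov d) (Q : Matrix (Fin n) (Fin n) ℝ) (y : Fin n → ℝ)
    (F : Set (Cov d → ℝ)) (f : Cov d → ℝ) : Prop :=
  f ∈ F ∧ ∀ g ∈ F, glsLoss X Q y f ≤ glsLoss X Q y g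

/-- `p` is a projection of `f₀` onto the class `F` for the empirical norm. -/
def IsProjection {d n : ℕ} (X : Fin n → Cov d) (F : Set (Cov d → ℝ)) (f₀ p : Cov d → ℝ) : Prop :=
  p ∈ F ∧ ∀ g ∈ F, empNorm X (fun x => p x - f₀ x) ≤ empNorm X (fun x => g x - f₀ x)

/-- The response `Yᵢ = f₀(Xᵢ) + ε(sᵢ)`. -/
def response {d n : ℕ} {Ω S : Type*} (f₀ : Cov d → ℝ) (X : Fin n → Cov d) (ε : S → Ω → ℝ)
    (s : Fin n → S) (i : Fin n) (ω : Ω) : ℝ :=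
  f₀ (X i) + ε (s i) ω

/-- The covariance matrix of a random vector. -/
def covMatrix {n : ℕ} {Ω : Type*} [MeasurableSpace Ω] (P : Measure Ω) (Y : Fin n → Ω → ℝ) :
    Matrix (Fin n) (Fin n) ℝ :=
  Matrix.of fun i j => covariance (Y i) (Y j) P

/-- Data generation. For each sample size `n` there are fixed covariates `X n` in a compact set
and locations `s n`; the errors are the values at these locations of a centered Gaussian process,
and the spectrum of `Cov(Y)` lies in `[Ψlow, Ψhigh]` for all `n`. -/
structure DataGeneration {d : ℕ} {Ω S : Type*} [MeasurableSpace Ω] (P : Measure Ω)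
    (Ψlow Ψhigh : ℝ) (f₀ : Cov d → ℝ) (K : Set (Cov d)) (X : (n : ℕ) → Fin n → Cov d)
    (ε : S → Ω → ℝ) (s : (n : ℕ) → Fin n → S) : Prop where
  isCompact : IsCompact K
  continuousOn : ContinuousOn f₀ K
  covariate_mem : ∀ n i, X n i ∈ K
  gaussian : IsGaussianProcess ε P
  centered : ∀ t, ∫ ω, ε t ω ∂P = 0
  spectrum_cov : ∀ n, ∀ μ ∈ spectrum ℝ (covMatrix P (response f₀ (X n) ε (s n))),
    Ψlow ≤ μ ∧ μ ≤ Ψhigh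

/-- The activation function and the growth of the sieve. The activation function is sigmoidal:
nondecreasing and Lipschitz, with values in `[-b, b]`. -/
structure SieveGrowth (σ : ℝ → ℝ) (b : ℝ) (L : ℝ≥0) (r : ℕ → ℕ) (V M : ℕ → ℝ) : Prop where
  monotone : Monotone σ
  lipschitz : LipschitzWith L σ
  range_mem : ∀ t, σ t ∈ Set.Icc (-b) b
  L_pos : 0 < L
  V_gt : ∀ n, 1 / (L : ℝ) < V n
  M_pos : ∀ n, 0 < M n
  r_tendsto : Tendsto r atTop atTop
  V_tendsto : Tendsto V atTop atTop
  M_tendsto : Tendsto M atTop atTop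
  scaling : (fun n => (r n : ℝ) * V n ^ 2 * Real.log (V n * r n)) =o[atTop] fun n => (n : ℝ)

/-- Spectral interval of the discrepancy matrix. `R n` is a square root `Σₙ^{1/2}`, i.e.
`Σₙ = R Rᵀ` (the symmetric root and the Cholesky factor are both allowed), and all eigenvalues of
`E = Rᵀ Q R` lie in `[Λlow, Λhigh]`, with `0 < Λlow ≤ 1 ≤ Λhigh` not depending on `n`. -/
structure SpectralInterval (Λlow Λhigh : ℝ) (Sig R Q : (n : ℕ) → Matrix (Fin n) (Fin n) ℝ) :
    Prop where
  low_pos : 0 < Λlow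
  low_le_one : Λlow ≤ 1
  one_le_high : 1 ≤ Λhigh
  sqrt_cov : ∀ n, R n * (R n)ᵀ = Sig n
  precision : ∀ n, (Q n).PosDef
  spectrum_discrepancy : ∀ n, ∀ μ ∈ spectrum ℝ ((R n)ᵀ * Q n * R n), Λlow ≤ μ ∧ μ ≤ Λhigh

end

end NNGLS

namespace NNGLS


/-! ### Covering numbers of the sieve by a Vapnik–Chervonenkis argument -/

section Covering

/-! Let `h` be the estimate minus the projection, `p` the projection minus `f₀`, `e` the noise, all
at the covariates, and `|x|_Q² = xᵀQx`. Comparing the losses of estimate and projection gives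
`|h|_Q² ≤ 2 hᵀQe - 2 hᵀQp`. Cauchy–Schwarz in `Q` handles `p`. For fixed `h`, `hᵀQe` is Gaussian
with variance at most `Λhigh |h|_Q²` (`quad_cov_mulVec_le`), so a union bound over a net of `n ^
O(r)` points gives `hᵀQe ≲ √Λhigh · t · |h|_Q` with `t² ≍ r log n`, up to an error from the net.
Hence `|h|_Q ≲ √Λhigh · t + |p|_Q` (`sqrt_quad_le_of_basic_inequality`). Passing between `|·|_Q` and
the Euclidean norm costs `√(Λhigh / Λlow)` and constants in `Ψlow`, `Ψhigh`.

The rate already carries `log n`, so one net of polynomially small mesh suffices, without chaining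
or localization. Its size must not involve the inner weights, as the growth of `M` is not tied to
`n`. This holds because superlevel sets of a monotone neuron are half-spaces, so Sauer–Shelah counts
their traces on the data (`exists_neuron_cover`, `exists_sieve_net`). -/

lemma sum_choose_le_pow (N D : ℕ) : ∑ k ∈ Finset.Iic D, N.choose k ≤ (N + 1) ^ D := by
  have hI : Finset.Iic D = Finset.range (D + 1) := by ext k; simp
  rw [add_pow, hI]
  refine Finset.sum_le_sum fun k hk => ?_
  have h1 : 1 ≤ D.choose k := Nat.choose_pos (by simpa [Nat.lt_succ_iff] using hk)
  calc N.choose k ≤ N ^ k := Nat.choose_le_pow N k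
    _ ≤ N ^ k * 1 ^ (D - k) * D.choose k := by
      rw [one_pow, mul_one]; exact Nat.le_mul_of_pos_right _ h1

/-- The Sauer–Shelah bound in polynomial form. -/
lemma card_le_pow_of_shatters {α : Type*} [Fintype α] [DecidableEq α] (𝒜 : Finset (Finset α))
    (D : ℕ) (h : ∀ s, 𝒜.Shatters s → s.card ≤ D) : 𝒜.card ≤ (Fintype.card α + 1) ^ D := by
  have hD : 𝒜.vcDim ≤ D := Finset.sup_le fun s hs => h s (Finset.mem_shatterer.1 hs)
  calc 𝒜.card ≤ 𝒜.shatterer.card := Finset.card_le_card_shatterer 𝒜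
    _ ≤ ∑ k ∈ Finset.Iic 𝒜.vcDim, (Fintype.card α).choose k := Finset.card_shatterer_le_sum_vcDim
    _ ≤ (Fintype.card α + 1) ^ 𝒜.vcDim := sum_choose_le_pow _ _
    _ ≤ _ := Nat.pow_le_pow_right (Nat.succ_pos _) hD

/-- Sets cut out by half-spaces through the origin have VC dimension at most the dimension. -/
lemma Shatters.card_le_finrank {α E : Type*} [DecidableEq α] [AddCommGroup E] [Module ℝ E]
    [FiniteDimensional ℝ E] {𝒜 : Finset (Finset α)} {s : Finset α} (hs : 𝒜.Shatters s)
    (φ : α → E) (h : ∀ S ∈ 𝒜, ∃ ℓ : E →ₗ[ℝ] ℝ, ∀ a ∈ s, a ∈ S ↔ 0 ≤ ℓ (φ a)) :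
    s.card ≤ Module.finrank ℝ E := by
  -- Given a linear dependence `g`, shattering yields a functional that is nonnegative exactly where
  -- `g > 0`. All terms `g a * ℓ (φ a)` are then nonnegative with sum zero, yet a negative `g i`
  -- would make its term strictly positive. Applied to `g` and `-g`, this gives independence.
  have key : ∀ g : s → ℝ, ∑ i, g i • φ i = 0 → ∀ i, 0 ≤ g i := by
    intro g hg i
    by_contra hi
    push Not at hi
    obtain ⟨S, hS, hSs⟩ := hs (Finset.filter_subset (fun a => ∃ ha : a ∈ s, 0 < g ⟨a, ha⟩) s)
    obtain ⟨ℓ, hℓ⟩ := h S hS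
    have hmem : ∀ a : s, 0 ≤ ℓ (φ a) ↔ 0 < g a := by
      intro a
      rw [← hℓ a a.2]
      have := Finset.ext_iff.1 hSs a
      simpa using this
    have h0 : ∑ a : s, g a * ℓ (φ a) = 0 := by
      have := congrArg ℓ hg
      simpa [map_sum] using this
    have hnn : ∀ a : s, 0 ≤ g a * ℓ (φ a) := by
      intro a
      rcases lt_or_ge 0 (g a) with hp | hp
      · exact mul_nonneg hp.le ((hmem a).2 hp)
      · refine mul_nonneg_of_nonpos_of_nonpos hp ?_
        by_contra hc
        exact absurd ((hmem a).1 (not_le.1 hc).le) (not_lt.2 hp)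
    have hz := (Finset.sum_eq_zero_iff_of_nonneg fun a _ => hnn a).1 h0 i (Finset.mem_univ _)
    have hlt : ℓ (φ i) < 0 := by
      by_contra hc
      exact absurd ((hmem i).1 (not_lt.1 hc)) (not_lt.2 hi.le)
    exact absurd hz (mul_pos_of_neg_of_neg hi hlt).ne'
  have hli : LinearIndependent ℝ fun a : s => φ a := by
    rw [Fintype.linearIndependent_iff]
    intro g hg i
    refine le_antisymm ?_ (key g hg i)
    have := key (-g) (by simp only [Pi.neg_apply, neg_smul, Finset.sum_neg_distrib, hg, neg_zero]) i
    simpa using this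
  simpa using hli.fintype_card_le_finrank

/-- A superlevel set of a monotone continuous function that is neither empty nor everything is a
closed half-line. -/
lemma exists_le_apply_iff {σ : ℝ → ℝ} (hm : Monotone σ) (hc : Continuous σ) {t u u' : ℝ}
    (hu : t ≤ σ u) (hu' : σ u' < t) : ∃ τ, ∀ v, t ≤ σ v ↔ τ ≤ v := by
  have hbdd : BddBelow {v | t ≤ σ v} := ⟨u', fun v hv => by
    by_contra h
    exact absurd (hv.trans (hm (not_le.1 h).le)) (not_le.2 hu')⟩
  have hcl : IsClosed {v | t ≤ σ v} := isClosed_le continuous_const hc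
  have hmem := hcl.csInf_mem ⟨u, hu⟩ hbdd
  exact ⟨sInf {v | t ≤ σ v}, fun v => ⟨fun hv => csInf_le hbdd hv, fun hv => hmem.trans (hm hv)⟩⟩

/-- The preactivation of a neuron. -/
def preact {d : ℕ} (γ : Cov d) (γ₀ : ℝ) (x : Cov d) : ℝ := (∑ i, γ i * x i) + γ₀

/-- Single neurons with a bounded activation function are covered in the sup norm over `n` points
by polynomially many vectors; the number does not depend on the size of the weights. -/
lemma exists_neuron_cover {d n : ℕ} {σ : ℝ → ℝ} {b δ : ℝ} (hm : Monotone σ) (hc : Continuous σ)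
    (hb : ∀ t, σ t ∈ Set.Icc (-b) b) (hδ : 0 < δ) (X : Fin n → Cov d) (N : ℕ)
    (hN : 2 * b < N * δ) :
    ∃ T : Finset (Fin n → ℝ), T.card ≤ (n * N + 1) ^ (d + 2) ∧ (∀ v ∈ T, ∀ i, |v i| ≤ b) ∧
      ∀ γ γ₀, ∃ v ∈ T, ∀ i, |σ (preact γ γ₀ (X i)) - v i| ≤ δ := by
  classical
  -- A neuron is encoded by the grid levels it reaches at each data point; this determines its
  -- values up to `δ`.
  let lev : Fin N → ℝ := fun k => -b + k * δ
  let S : Cov d × ℝ → Finset (Fin n × Fin N) := fun p =>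
    Finset.univ.filter fun a => lev a.2 ≤ σ (preact p.1 p.2 (X a.1))
  let 𝒜 : Finset (Finset (Fin n × Fin N)) := Finset.univ.filter fun A => ∃ p, S p = A
  have hA : 𝒜.card ≤ (n * N + 1) ^ (d + 2) := by
    have := card_le_pow_of_shatters 𝒜 (d + 2) ?_
    · simpa using this
    intro s hs
    -- Cutting out `s` itself and `∅` shows that the level of a shattered pair is reached by some
    -- neuron and missed by another, so its superlevel set is a proper half-line. Off `s` the value
    -- of `τ` is irrelevant.
    have hτ : ∀ a : Fin n × Fin N, ∃ τ, a ∈ s → ∀ v, lev a.2 ≤ σ v ↔ τ ≤ v := by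
      intro a
      by_cases ha : a ∈ s
      · obtain ⟨A, hA, hAs⟩ := hs (Finset.Subset.refl s)
        obtain ⟨B, hB, hBs⟩ := hs (Finset.empty_subset s)
        obtain ⟨p, rfl⟩ := (Finset.mem_filter.1 hA).2
        obtain ⟨q, rfl⟩ := (Finset.mem_filter.1 hB).2
        have h1 : a ∈ S p := (Finset.mem_inter.1 (hAs.symm ▸ ha)).2
        have h2 : a ∉ S q := fun h => by
          have : a ∈ s ∩ S q := Finset.mem_inter.2 ⟨ha, h⟩
          simp [hBs] at this
        simp only [S, Finset.mem_filter, Finset.mem_univ, true_and, not_le] at h1 h2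
        obtain ⟨τ, h⟩ := exists_le_apply_iff hm hc h1 h2
        exact ⟨τ, fun _ => h⟩
      · exact ⟨0, fun h => absurd h ha⟩
    choose τ hτ using hτ
    have hfr : Module.finrank ℝ (Cov d × ℝ × ℝ) = d + 2 := by simp
    rw [← hfr]
    -- Reaching the level now means `γᵀx + γ₀ - τ ≥ 0`, which is linear in `(x, 1, τ)`.
    refine Shatters.card_le_finrank hs (fun a => (X a.1, (1 : ℝ), τ a)) ?_
    intro A hA
    obtain ⟨p, rfl⟩ := (Finset.mem_filter.1 hA).2
    refine ⟨{ toFun := fun z => (∑ j, p.1 j * z.1 j) + p.2 * z.2.1 - z.2.2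
              map_add' := fun y z => ?_
              map_smul' := fun c z => ?_ }, fun a ha => ?_⟩
    · simp only [Prod.fst_add, Prod.snd_add, PiLp.add_apply, mul_add, Finset.sum_add_distrib]
      ring
    · simp only [Prod.smul_fst, Prod.smul_snd, PiLp.smul_apply, smul_eq_mul, RingHom.id_apply,
        mul_sub, mul_add, Finset.mul_sum]
      congr 2
      · exact Finset.sum_congr rfl fun j _ => by ring
      · ring
    · simp [S, hτ a ha, preact]
  choose! ρ hρ using fun (A : Finset (Fin n × Fin N)) (hA : A ∈ 𝒜) => (Finset.mem_filter.1 hA).2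
  refine ⟨𝒜.image fun A i => σ (preact (ρ A).1 (ρ A).2 (X i)), Finset.card_image_le.trans hA,
    ?_, ?_⟩
  · intro v hv i
    obtain ⟨A, -, rfl⟩ := Finset.mem_image.1 hv
    exact abs_le.2 (hb _)
  · intro γ γ₀
    have hmem : S (γ, γ₀) ∈ 𝒜 := by simp [𝒜]
    refine ⟨_, Finset.mem_image_of_mem _ hmem, fun i => ?_⟩
    have hS := hρ _ hmem
    set q := ρ (S (γ, γ₀))
    -- The highest level below `σ u` is within `δ` of it; strictness in `hN` keeps its index below
    -- `N`.
    have key : ∀ u u' : ℝ, (∀ k : Fin N, lev k ≤ σ u → lev k ≤ σ u') → σ u - σ u' ≤ δ := by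
      intro u u' h
      have h0 : 0 ≤ (σ u + b) / δ := div_nonneg (by linarith [(hb u).1]) hδ.le
      have hk : ⌊(σ u + b) / δ⌋₊ < N := by
        rw [Nat.floor_lt h0, div_lt_iff₀ hδ]
        linarith [(hb u).2]
      have h1 := Nat.floor_le h0
      have h2 := Nat.lt_floor_add_one ((σ u + b) / δ)
      rw [le_div_iff₀ hδ] at h1
      rw [div_lt_iff₀ hδ] at h2
      have := h ⟨_, hk⟩ (by simp only [lev]; linarith)
      simp only [lev] at this
      linarith
    have hiff : ∀ k, lev k ≤ σ (preact γ γ₀ (X i)) ↔ lev k ≤ σ (preact q.1 q.2 (X i)) := by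
      intro k
      have := Finset.ext_iff.1 hS (i, k)
      simpa [S] using this.symm
    rw [abs_sub_le_iff]
    exact ⟨key _ _ fun k => (hiff k).1, key _ _ fun k => (hiff k).2⟩

lemma exists_real_cover {V δ : ℝ} (hδ : 0 < δ) (m : ℕ) (hm : V ≤ m * δ) :
    ∃ A : Finset ℝ, A.card ≤ 2 * m + 3 ∧ ∀ a, |a| ≤ V → ∃ a' ∈ A, |a - a'| ≤ δ := by
  classical
  refine ⟨(Finset.Icc (-(m + 1 : ℤ)) (m + 1)).image fun k : ℤ => k * δ,
    Finset.card_image_le.trans (by simp; omega), fun a ha => ?_⟩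
  have h1 := Int.floor_le (a / δ)
  have h2 := Int.lt_floor_add_one (a / δ)
  have hb := abs_le.1 (ha.trans hm)
  have h3 : a / δ ≤ m := by rw [div_le_iff₀ hδ]; exact hb.2
  have h4 : -(m : ℝ) ≤ a / δ := by rw [le_div_iff₀ hδ]; linarith [hb.1]
  refine ⟨⌊a / δ⌋ * δ, Finset.mem_image_of_mem _ (Finset.mem_Icc.2 ⟨?_, ?_⟩), ?_⟩
  · have : (-(m + 1 : ℤ) : ℝ) < (⌊a / δ⌋ : ℝ) + 1 := by push_cast; linarith
    exact_mod_cast Int.lt_add_one_iff.1 (by exact_mod_cast this)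
  · have : (⌊a / δ⌋ : ℝ) ≤ ((m + 1 : ℤ) : ℝ) := by push_cast; linarith
    exact_mod_cast this
  · rw [le_div_iff₀ hδ] at h1
    rw [div_lt_iff₀ hδ] at h2
    rw [abs_le]; constructor <;> linarith

/-- A sup-norm cover, over `n` points, of the values of a network sieve; the number of elements
does not depend on the bound `M` for the inner weights. -/
lemma exists_sieve_cover {d n r : ℕ} {σ : ℝ → ℝ} {b δ V M : ℝ} (hm : Monotone σ)
    (hc : Continuous σ) (hb : ∀ t, σ t ∈ Set.Icc (-b) b) (hδ : 0 < δ) (X : Fin n → Cov d)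
    (N m : ℕ) (hN : 2 * b < N * δ) (hV : V ≤ m * δ) :
    ∃ T : Finset (Fin n → ℝ),
      T.card ≤ (2 * m + 3) ^ (r + 1) * ((n * N + 1) ^ (d + 2)) ^ r ∧
      ∀ f ∈ sieve d σ r V M, ∃ v ∈ T, ∀ i, |f (X i) - v i| ≤ δ * (1 + r * b + V) := by
  classical
  obtain ⟨T, hTc, hTb, hT⟩ := exists_neuron_cover hm hc hb hδ X N hN
  obtain ⟨A, hAc, hA⟩ := exists_real_cover hδ m hV
  refine ⟨(A ×ˢ (Fintype.piFinset fun _ : Fin r => A) ×ˢ Fintype.piFinset fun _ : Fin r => T).image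
    fun z i => z.1 + ∑ j, z.2.1 j * z.2.2 j i, ?_, ?_⟩
  · refine Finset.card_image_le.trans ?_
    simp only [Finset.card_product, Fintype.card_piFinset, Finset.prod_const, Finset.card_univ,
      Fintype.card_fin]
    rw [← mul_assoc, ← pow_succ']
    gcongr
  · rintro f ⟨α₀, α, γ₀, γ, hα, -, rfl⟩
    have hnn : ∀ j ∈ Finset.univ, 0 ≤ |α j| := fun j _ => abs_nonneg _
    have hs := Finset.sum_nonneg hnn
    obtain ⟨a₀, ha₀, h₀⟩ := hA α₀ (by linarith)
    choose a ha hd using fun j => hA (α j) (by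
      linarith [Finset.single_le_sum hnn (Finset.mem_univ j), abs_nonneg α₀])
    choose v hv hvd using fun j => hT (γ j) (γ₀ j)
    refine ⟨_, Finset.mem_image_of_mem _ (a := (a₀, a, v)) (Finset.mem_product.2
      ⟨ha₀, Finset.mem_product.2
      ⟨Fintype.mem_piFinset.2 ha, Fintype.mem_piFinset.2 hv⟩⟩), fun i => ?_⟩
    -- Errors in the outer weights accumulate to `r * b * δ`, while errors in the neurons are
    -- weighted by `|α j|` and cost only `V * δ`.
    have hterm : ∀ j, |α j * σ (preact (γ j) (γ₀ j) (X i)) - a j * v j i|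
        ≤ δ * b + |α j| * δ := by
      intro j
      have : α j * σ (preact (γ j) (γ₀ j) (X i)) - a j * v j i
          = (α j - a j) * v j i + α j * (σ (preact (γ j) (γ₀ j) (X i)) - v j i) := by ring
      rw [this]
      refine (abs_add_le _ _).trans ?_
      rw [abs_mul, abs_mul]
      have h1 := hd j
      have h2 := hTb _ (hv j) i
      have h3 := hvd j i
      gcongr
    have hsplit : (α₀ + ∑ j, α j * σ ((∑ l, γ j l * X i l) + γ₀ j)) - (a₀ + ∑ j, a j * v j i)
        = (α₀ - a₀) + ∑ j, (α j * σ (preact (γ j) (γ₀ j) (X i)) - a j * v j i) := by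
      simp only [preact, Finset.sum_sub_distrib]; ring
    change |(α₀ + ∑ j, α j * σ ((∑ l, γ j l * X i l) + γ₀ j)) - (a₀ + ∑ j, a j * v j i)| ≤ _
    rw [hsplit]
    have h5 := (Finset.abs_sum_le_sum_abs _ _).trans (Finset.sum_le_sum fun j (_ : j ∈ Finset.univ)
      => hterm j)
    rw [Finset.sum_add_distrib] at h5
    simp only [Finset.sum_const, Finset.card_univ, Fintype.card_fin, nsmul_eq_mul] at h5
    have h6 : ∑ j, |α j| * δ ≤ V * δ := by
      rw [← Finset.sum_mul]
      exact mul_le_mul_of_nonneg_right (by linarith [abs_nonneg α₀]) hδ.le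
    refine (abs_add_le _ _).trans ((add_le_add h₀ h5).trans ?_)
    linarith

end Covering


/-! ### Gaussian tails and the union bound -/

section GaussianTails

variable {Ω : Type*} [MeasurableSpace Ω] {P : Measure Ω}

lemma measure_lt_le_of_hasGaussianLaw {Z : Ω → ℝ} (hZ : HasGaussianLaw Z P)
    (h0 : ∫ ω, Z ω ∂P = 0) {t : ℝ} (ht : 0 ≤ t) :
    P {ω | t * √(Var[Z; P]) < Z ω} ≤ ENNReal.ofReal (Real.exp (-t ^ 2 / 2)) := by
  have := hZ.isProbabilityMeasure
  have hmap := hZ.map_eq_gaussianReal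
  rw [h0] at hmap
  -- For zero variance the strict inequality defining the event makes it null.
  rcases (variance_nonneg Z P).eq_or_lt with hv | hv
  · rw [← hv] at hmap ⊢
    have hP : P {ω | t * √0 < Z ω} = P.map Z (Set.Ioi 0) := by
      rw [Measure.map_apply_of_aemeasurable hZ.aemeasurable measurableSet_Ioi]
      simp only [Real.sqrt_zero, mul_zero]; rfl
    rw [hP, hmap]
    simp
  · set v := Var[Z; P] with hvdef
    -- The optimal Chernoff parameter.
    set l : ℝ := t / √v
    have hl : 0 ≤ l := by positivity
    have hint : Integrable (fun ω => Real.exp (l * Z ω)) P := by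
      have := integrable_exp_mul_gaussianReal (μ := 0) (v := v.toNNReal) l
      rw [← hmap] at this
      exact this.comp_aemeasurable hZ.aemeasurable
    have hch := measure_ge_le_exp_mul_mgf (μ := P) (X := Z) (t * √v) hl hint
    rw [mgf_gaussianReal hmap, ← Real.exp_add, Real.coe_toNNReal _ hv.le] at hch
    have hexp : -l * (t * √v) + (0 * l + v * l ^ 2 / 2) = -t ^ 2 / 2 := by
      have hs : √v ≠ 0 := (Real.sqrt_pos.2 hv).ne'
      have h1 : l * √v = t := div_mul_cancel₀ _ hs
      have h2 : v * l ^ 2 = t ^ 2 := by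
        rw [← h1, mul_pow, Real.sq_sqrt hv.le]; ring
      rw [h2]
      linear_combination -t * h1
    rw [hexp] at hch
    refine (measure_mono fun ω (hω : t * √v < Z ω) => show t * √v ≤ Z ω from hω.le).trans ?_
    exact (ENNReal.le_ofReal_iff_toReal_le (measure_ne_top _ _) (Real.exp_pos _).le).2 hch

/-- A linear combination of the errors exceeds `t` standard deviations with probability at most
`exp (-t² / 2)`. -/
lemma measure_lt_dotProduct_le {n d : ℕ} {S : Type*} {ε : S → Ω → ℝ} (hε : IsGaussianProcess ε P)
    (h0 : ∀ t, ∫ ω, ε t ω ∂P = 0) (f₀ : Cov d → ℝ) (X : Fin n → Cov d) (s : Fin n → S)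
    (w : Fin n → ℝ) {t : ℝ} (ht : 0 ≤ t) :
    P {ω | t * √(w ⬝ᵥ (covMatrix P (response f₀ X ε s) *ᵥ w)) < w ⬝ᵥ fun i => ε (s i) ω}
      ≤ ENNReal.ofReal (Real.exp (-t ^ 2 / 2)) := by
  have := hε.isProbabilityMeasure
  have hp := (hε.comp_right s).smul w
  have hlaw := hp.hasGaussianLaw_fun_sum (I := Finset.univ)
  have hL2 : ∀ i, MemLp (ε (s i)) 2 P := fun i => (hε.hasGaussianLaw_eval _).memLp_two
  have hint : ∀ i, Integrable (ε (s i)) P := fun i => (hε.hasGaussianLaw_eval _).integrable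
  have hmean : ∫ ω, ∑ i, w i • (ε ∘ s) i ω ∂P = 0 := by
    rw [integral_finsetSum (f := fun i ω => w i • (ε ∘ s) i ω) _ fun i _ => (hint i).smul (w i)]
    exact Finset.sum_eq_zero fun i _ => by
      simp only [Function.comp, smul_eq_mul, integral_const_mul, h0, mul_zero]
  have hvar : Var[fun ω => ∑ i, w i • (ε ∘ s) i ω; P]
      = w ⬝ᵥ (covMatrix P (response f₀ X ε s) *ᵥ w) := by
    rw [variance_fun_sum (X := fun i ω => w i • (ε ∘ s) i ω) fun i => (hL2 i).const_smul (w i)]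
    simp only [dotProduct, mulVec, Finset.mul_sum]
    refine Finset.sum_congr rfl fun i _ => Finset.sum_congr rfl fun j _ => ?_
    have hc : covMatrix P (response f₀ X ε s) i j = cov[ε (s i), ε (s j); P] := by
      simp only [covMatrix, Matrix.of_apply]
      change cov[fun ω => f₀ (X i) + ε (s i) ω, fun ω => f₀ (X j) + ε (s j) ω; P] = _
      rw [covariance_const_add_left (hint i), covariance_const_add_right (hint j)]
    rw [hc]
    simp only [Function.comp, smul_eq_mul, covariance_const_mul_left, covariance_const_mul_right]
    ring
  have := measure_lt_le_of_hasGaussianLaw hlaw hmean ht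
  rw [hvar] at this
  exact this

/-- Union bound over finitely many linear combinations. -/
lemma measure_exists_lt_dotProduct_le {n d : ℕ} {S : Type*} {ε : S → Ω → ℝ}
    (hε : IsGaussianProcess ε P) (h0 : ∀ t, ∫ ω, ε t ω ∂P = 0) (f₀ : Cov d → ℝ)
    (X : Fin n → Cov d) (s : Fin n → S) (W : Finset (Fin n → ℝ)) {t : ℝ} (ht : 0 ≤ t) :
    P {ω | ∃ w ∈ W, t * √(w ⬝ᵥ (covMatrix P (response f₀ X ε s) *ᵥ w))
        < w ⬝ᵥ fun i => ε (s i) ω} ≤ ENNReal.ofReal (W.card * Real.exp (-t ^ 2 / 2)) := by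
  have hset : {ω | ∃ w ∈ W, t * √(w ⬝ᵥ (covMatrix P (response f₀ X ε s) *ᵥ w))
        < w ⬝ᵥ fun i => ε (s i) ω} = ⋃ w ∈ W, {ω | t * √(w ⬝ᵥ
        (covMatrix P (response f₀ X ε s) *ᵥ w)) < w ⬝ᵥ fun i => ε (s i) ω} := by
    ext ω; simp
  rw [hset]
  refine (measure_biUnion_finset_le _ _).trans ((Finset.sum_le_sum fun w _ =>
    measure_lt_dotProduct_le hε h0 f₀ X s w ht).trans ?_)
  rw [Finset.sum_const, nsmul_eq_mul, ENNReal.ofReal_mul (Nat.cast_nonneg _),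
    ENNReal.ofReal_natCast]

end GaussianTails


/-! ### Quadratic forms, spectral bounds and Cauchy–Schwarz -/

section QuadraticForms

variable {n : ℕ}

/-- The quadratic form `xᵀ A x`. -/
def quad (A : Matrix (Fin n) (Fin n) ℝ) (x : Fin n → ℝ) : ℝ := x ⬝ᵥ (A *ᵥ x)

lemma le_quad_of_spectrum {A : Matrix (Fin n) (Fin n) ℝ} (hA : A.IsHermitian) {c : ℝ}
    (h : ∀ μ ∈ spectrum ℝ A, c ≤ μ) (x : Fin n → ℝ) : c * (x ⬝ᵥ x) ≤ quad A x := by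
  have hps : (A - algebraMap ℝ _ c).PosSemidef := by
    rw [posSemidef_iff_isHermitian_and_spectrum_nonneg]
    refine ⟨hA.sub ?_, fun μ hμ => ?_⟩
    · rw [Matrix.algebraMap_eq_diagonal]
      exact isHermitian_diagonal _
    · have : μ + c ∈ spectrum ℝ A := by
        rw [spectrum.add_mem_iff, neg_add_eq_sub]
        exact hμ
      have := h _ this
      change 0 ≤ μ
      linarith
  have := hps.dotProduct_mulVec_nonneg x
  rw [Algebra.algebraMap_eq_smul_one, sub_mulVec, dotProduct_sub, smul_mulVec, one_mulVec,
    dotProduct_smul, star_trivial, smul_eq_mul] at this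
  exact sub_nonneg.1 this

lemma quad_le_of_spectrum {A : Matrix (Fin n) (Fin n) ℝ} (hA : A.IsHermitian) {c : ℝ}
    (h : ∀ μ ∈ spectrum ℝ A, μ ≤ c) (x : Fin n → ℝ) : quad A x ≤ c * (x ⬝ᵥ x) := by
  have := le_quad_of_spectrum hA.neg (c := -c) (fun μ hμ => by
    rw [← spectrum.neg_eq, Set.mem_neg] at hμ
    linarith [h _ hμ]) x
  simp only [quad, neg_mulVec, dotProduct_neg] at this
  simp only [quad]
  linarith

lemma dotProduct_mulVec_comm_of_isHermitian {A : Matrix (Fin n) (Fin n) ℝ} (hA : A.IsHermitian)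
    (x y : Fin n → ℝ) : x ⬝ᵥ (A *ᵥ y) = y ⬝ᵥ (A *ᵥ x) := by
  have hT : Aᵀ = A := (conjTranspose_eq_transpose_of_trivial A).symm.trans hA.eq
  rw [dotProduct_mulVec, ← mulVec_transpose, hT, dotProduct_comm]

lemma quad_add {A : Matrix (Fin n) (Fin n) ℝ} (hA : A.IsHermitian) (x y : Fin n → ℝ) :
    quad A (x + y) = quad A x + 2 * (x ⬝ᵥ (A *ᵥ y)) + quad A y := by
  simp only [quad, mulVec_add, dotProduct_add, add_dotProduct,
    dotProduct_mulVec_comm_of_isHermitian hA y x]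
  ring

lemma quad_smul (A : Matrix (Fin n) (Fin n) ℝ) (c : ℝ) (x : Fin n → ℝ) :
    quad A (c • x) = c ^ 2 * quad A x := by
  simp only [quad, mulVec_smul, dotProduct_smul, smul_dotProduct, smul_eq_mul]
  ring

lemma quad_neg (A : Matrix (Fin n) (Fin n) ℝ) (x : Fin n → ℝ) : quad A (-x) = quad A x := by
  simp [quad, mulVec_neg]

lemma quad_nonneg {A : Matrix (Fin n) (Fin n) ℝ} (hA : A.PosDef) (x : Fin n → ℝ) :
    0 ≤ quad A x := by
  simpa [quad] using hA.posSemidef.dotProduct_mulVec_nonneg x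

/-- Cauchy–Schwarz for the bilinear form of a positive definite matrix. -/
lemma sq_dotProduct_mulVec_le {A : Matrix (Fin n) (Fin n) ℝ} (hA : A.PosDef) (x y : Fin n → ℝ) :
    (x ⬝ᵥ (A *ᵥ y)) ^ 2 ≤ quad A x * quad A y := by
  have := discrim_le_zero (a := quad A y) (b := 2 * (x ⬝ᵥ (A *ᵥ y))) (c := quad A x) fun t => by
    have := quad_nonneg hA (x + t • y)
    rw [quad_add hA.1, quad_smul, mulVec_smul, dotProduct_smul, smul_eq_mul] at this
    linarith
  rw [discrim] at this
  linarith

lemma abs_dotProduct_mulVec_le {A : Matrix (Fin n) (Fin n) ℝ} (hA : A.PosDef)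
    (x y : Fin n → ℝ) : |x ⬝ᵥ (A *ᵥ y)| ≤ √(quad A x) * √(quad A y) := by
  rw [← Real.sqrt_mul (quad_nonneg hA x)]
  exact Real.abs_le_sqrt (sq_dotProduct_mulVec_le hA x y)

lemma sqrt_quad_add_le {A : Matrix (Fin n) (Fin n) ℝ} (hA : A.PosDef) (x y : Fin n → ℝ) :
    √(quad A (x + y)) ≤ √(quad A x) + √(quad A y) := by
  refine Real.sqrt_le_iff.2 ⟨by positivity, ?_⟩
  rw [quad_add hA.1, add_sq, Real.sq_sqrt (quad_nonneg hA x), Real.sq_sqrt (quad_nonneg hA y)]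
  linarith [(le_abs_self _).trans (abs_dotProduct_mulVec_le hA x y)]

lemma quad_one (x : Fin n → ℝ) : quad 1 x = x ⬝ᵥ x := by simp [quad]

lemma dotProduct_self_nonneg_real (x : Fin n → ℝ) : 0 ≤ x ⬝ᵥ x :=
  Finset.sum_nonneg fun i _ => mul_self_nonneg (x i)

lemma sq_dotProduct_le (x y : Fin n → ℝ) : (x ⬝ᵥ y) ^ 2 ≤ (x ⬝ᵥ x) * (y ⬝ᵥ y) := by
  simpa [quad_one] using sq_dotProduct_mulVec_le (PosDef.one (n := Fin n) (R := ℝ)) x y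

lemma dotProduct_self_le {x : Fin n → ℝ} {c : ℝ} (h : ∀ i, |x i| ≤ c) :
    x ⬝ᵥ x ≤ n * c ^ 2 := by
  calc x ⬝ᵥ x ≤ ∑ _i : Fin n, c ^ 2 := Finset.sum_le_sum fun i _ => by
        rw [← sq]; exact sq_le_sq.2 ((h i).trans (le_abs_self c))
    _ = n * c ^ 2 := by simp

end QuadraticForms

/-! ### The discrepancy matrix and the basic inequality -/

section Discrepancy

variable {n : ℕ} {Sig R Q : Matrix (Fin n) (Fin n) ℝ} {Λlow Λhigh Ψlow Ψhigh : ℝ}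

lemma le_of_sq_le_mul {s c : ℝ} (hc : 0 ≤ c) (h : s ^ 2 ≤ s * c) : s ≤ c := by
  by_contra hs
  push Not at hs
  nlinarith

lemma dotProduct_mulVec_transpose (A : Matrix (Fin n) (Fin n) ℝ) (x y : Fin n → ℝ) :
    (Aᵀ *ᵥ x) ⬝ᵥ y = x ⬝ᵥ (A *ᵥ y) := by
  rw [mulVec_transpose, dotProduct_mulVec]

lemma quad_mulVec (A B : Matrix (Fin n) (Fin n) ℝ) (x : Fin n → ℝ) :
    quad A (B *ᵥ x) = quad (Bᵀ * A * B) x := by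
  simp only [quad, ← mulVec_mulVec, Matrix.mul_assoc]
  rw [dotProduct_comm x, dotProduct_mulVec_transpose, dotProduct_comm]

lemma isHermitian_discrepancy (hQ : Q.PosDef) : (Rᵀ * Q * R).IsHermitian := by
  rw [← conjTranspose_eq_transpose_of_trivial]
  exact isHermitian_conjTranspose_mul_mul R hQ.1

/-- The variance of `hᵀ Q ε` is at most `Λhigh` times `hᵀ Q h`. -/
lemma quad_cov_mulVec_le (hR : R * Rᵀ = Sig) (hQ : Q.PosDef)
    (hE : ∀ μ ∈ spectrum ℝ (Rᵀ * Q * R), μ ≤ Λhigh) (hΛ : 0 ≤ Λhigh) (h : Fin n → ℝ) :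
    quad Sig (Q *ᵥ h) ≤ Λhigh * quad Q h := by
  set w := Rᵀ *ᵥ (Q *ᵥ h) with hw
  have h1 : quad Sig (Q *ᵥ h) = w ⬝ᵥ w := by
    rw [hw, dotProduct_mulVec_transpose, mulVec_mulVec, hR, quad]
  -- Cauchy–Schwarz in `Q` turns this into `|w|⁴ ≤ (wᵀEw)(hᵀQh) ≤ Λhigh |w|² (hᵀQh)`, and one factor
  -- `|w|²` cancels.
  have h2 : w ⬝ᵥ w = (R *ᵥ w) ⬝ᵥ (Q *ᵥ h) := by
    nth_rw 1 [hw]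
    rw [dotProduct_mulVec_transpose, dotProduct_comm]
  have h3 := sq_dotProduct_mulVec_le hQ (R *ᵥ w) h
  rw [← h2, quad_mulVec] at h3
  have h4 := quad_le_of_spectrum (isHermitian_discrepancy (R := R) hQ) hE w
  rw [h1]
  refine le_of_sq_le_mul (mul_nonneg hΛ (quad_nonneg hQ h)) (h3.trans ?_)
  refine (mul_le_mul_of_nonneg_right h4 (quad_nonneg hQ h)).trans (le_of_eq ?_)
  ring

/-- The vector `u = Rᵀ Σ⁻¹ h` plays the role of `R⁻¹h`, with `|u|² = hᵀΣ⁻¹h`. It turns `hᵀQh` into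
`uᵀEu`, so spectral bounds on `E` become bounds on `Q`. -/
lemma exists_mulVec_eq (hR : R * Rᵀ = Sig) (hΨ : 0 < Ψlow)
    (hS : ∀ μ ∈ spectrum ℝ Sig, Ψlow ≤ μ ∧ μ ≤ Ψhigh) (hΨ' : 0 ≤ Ψhigh) (h : Fin n → ℝ) :
    ∃ u, R *ᵥ u = h ∧ Ψlow * (u ⬝ᵥ u) ≤ h ⬝ᵥ h ∧ h ⬝ᵥ h ≤ Ψhigh * (u ⬝ᵥ u) := by
  have hSH : Sig.IsHermitian := by
    rw [← hR, ← conjTranspose_eq_transpose_of_trivial]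
    exact isHermitian_mul_conjTranspose_self R
  have hunit : IsUnit Sig := by
    rw [← spectrum.zero_notMem_iff ℝ]
    exact fun h0 => absurd (hS 0 h0).1 (not_le.2 hΨ)
  obtain ⟨g, hg⟩ := mulVec_surjective_iff_isUnit.2 hunit h
  have hu : R *ᵥ (Rᵀ *ᵥ g) = h := by rw [mulVec_mulVec, hR, hg]
  refine ⟨Rᵀ *ᵥ g, hu, ?_, ?_⟩
  · have h1 : (Rᵀ *ᵥ g) ⬝ᵥ (Rᵀ *ᵥ g) = g ⬝ᵥ h := by rw [dotProduct_mulVec_transpose, hu]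
    have h2 := le_quad_of_spectrum hSH (fun μ hμ => (hS μ hμ).1) g
    rw [quad, hg] at h2
    have h3 := sq_dotProduct_le g h
    have h0 := dotProduct_self_nonneg_real (Rᵀ *ᵥ g)
    rw [h1] at h0 ⊢
    refine le_of_sq_le_mul (dotProduct_self_nonneg_real h) ?_
    have h4 : Ψlow * (g ⬝ᵥ h) ^ 2 ≤ (g ⬝ᵥ h) * (h ⬝ᵥ h) := by
      have := mul_le_mul_of_nonneg_right h2 (dotProduct_self_nonneg_real h)
      nlinarith
    nlinarith
  · set u := Rᵀ *ᵥ g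
    have h1 : h ⬝ᵥ h = (Rᵀ *ᵥ h) ⬝ᵥ u := by rw [dotProduct_mulVec_transpose, hu]
    have h2 : (Rᵀ *ᵥ h) ⬝ᵥ (Rᵀ *ᵥ h) = quad Sig h := by
      rw [dotProduct_mulVec_transpose, mulVec_mulVec, hR, quad]
    have h3 := sq_dotProduct_le (Rᵀ *ᵥ h) u
    rw [← h1, h2] at h3
    have h4 := quad_le_of_spectrum hSH (fun μ hμ => (hS μ hμ).2) h
    have hu0 := dotProduct_self_nonneg_real u
    refine le_of_sq_le_mul (mul_nonneg hΨ' hu0) (h3.trans ?_)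
    refine (mul_le_mul_of_nonneg_right h4 hu0).trans (le_of_eq ?_)
    ring

lemma quad_precision_le (hR : R * Rᵀ = Sig) (hQ : Q.PosDef)
    (hE : ∀ μ ∈ spectrum ℝ (Rᵀ * Q * R), μ ≤ Λhigh) (hΛ : 0 ≤ Λhigh) (hΨ : 0 < Ψlow)
    (hS : ∀ μ ∈ spectrum ℝ Sig, Ψlow ≤ μ ∧ μ ≤ Ψhigh) (hΨ' : 0 ≤ Ψhigh) (h : Fin n → ℝ) :
    quad Q h ≤ Λhigh / Ψlow * (h ⬝ᵥ h) := by
  obtain ⟨u, hu, h1, -⟩ := exists_mulVec_eq hR hΨ hS hΨ' h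
  have h2 := quad_le_of_spectrum (isHermitian_discrepancy (R := R) hQ) hE u
  rw [← quad_mulVec, hu] at h2
  rw [div_mul_eq_mul_div, le_div_iff₀ hΨ]
  nlinarith

lemma dotProduct_self_le_quad (hR : R * Rᵀ = Sig) (hQ : Q.PosDef)
    (hE : ∀ μ ∈ spectrum ℝ (Rᵀ * Q * R), Λlow ≤ μ) (hΛ : 0 < Λlow) (hΨ : 0 < Ψlow)
    (hS : ∀ μ ∈ spectrum ℝ Sig, Ψlow ≤ μ ∧ μ ≤ Ψhigh) (hΨ' : 0 ≤ Ψhigh) (h : Fin n → ℝ) :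
    h ⬝ᵥ h ≤ Ψhigh / Λlow * quad Q h := by
  obtain ⟨u, hu, -, h1⟩ := exists_mulVec_eq hR hΨ hS hΨ' h
  have h2 := le_quad_of_spectrum (isHermitian_discrepancy (R := R) hQ) hE u
  rw [← quad_mulVec, hu] at h2
  rw [div_mul_eq_mul_div, le_div_iff₀ hΛ]
  nlinarith

/-- The deterministic part of the argument: `h` is the estimation error relative to the
projection, `p` the approximation error, `e` the noise, and `k` a point of the net near `h`. -/
lemma sqrt_quad_le_of_basic_inequality (hR : R * Rᵀ = Sig) (hQ : Q.PosDef)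
    (hE : ∀ μ ∈ spectrum ℝ (Rᵀ * Q * R), μ ≤ Λhigh) (hΛ : 1 ≤ Λhigh) (hΨ : 0 < Ψlow)
    (hS : ∀ μ ∈ spectrum ℝ Sig, Ψlow ≤ μ ∧ μ ≤ Ψhigh) (hΨ' : 0 ≤ Ψhigh)
    {h k p e : Fin n → ℝ} {t δ : ℝ} (ht : 1 ≤ t)
    (hloss : quad Q (e - p - h) ≤ quad Q (e - p))
    (hk : (Q *ᵥ k) ⬝ᵥ e ≤ t * √(quad Sig (Q *ᵥ k)))
    (he : ∀ i, |e i| ≤ t * √Ψhigh) (hδ : ∀ i, |(h - k) i| ≤ δ)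
    (hδ1 : n * δ ^ 2 ≤ Ψlow) (hδ2 : (n * δ ^ 2) * (n * Ψhigh) ≤ Ψlow ^ 2) :
    √(quad Q h) ≤ 4 * (√Λhigh * t) + 2 * √(quad Q p) := by
  have hΛ0 : 0 ≤ Λhigh := by linarith
  set a := √(quad Q h)
  set q := √(quad Q p)
  set z := h - k with hz
  have ha0 : 0 ≤ a := Real.sqrt_nonneg _
  have hq0 : 0 ≤ q := Real.sqrt_nonneg _
  have ha2 : a ^ 2 = quad Q h := Real.sq_sqrt (quad_nonneg hQ h)
  set l := √Λhigh * t with hl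
  have hl2 : l ^ 2 = Λhigh * t ^ 2 := by rw [hl, mul_pow, Real.sq_sqrt hΛ0]
  have hl0 : 0 ≤ l := by positivity
  have hzz := dotProduct_self_le hδ
  have hee : e ⬝ᵥ e ≤ n * Ψhigh * t ^ 2 := by
    refine (dotProduct_self_le he).trans (le_of_eq ?_)
    rw [mul_pow, Real.sq_sqrt hΨ']; ring
  have hzQ : quad Q z ≤ Λhigh := by
    refine (quad_precision_le hR hQ hE hΛ0 hΨ hS hΨ' z).trans ?_
    rw [div_mul_eq_mul_div, div_le_iff₀ hΨ]
    gcongr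
    linarith
  -- Discretization error: the mesh is so fine that the crude coordinatewise bound on the noise
  -- suffices.
  have hze : |z ⬝ᵥ (Q *ᵥ e)| ≤ l ^ 2 := by
    refine abs_le_of_sq_le_sq ?_ (sq_nonneg l)
    refine (sq_dotProduct_mulVec_le hQ z e).trans ?_
    calc quad Q z * quad Q e
        ≤ (Λhigh / Ψlow * (n * δ ^ 2)) * (Λhigh / Ψlow * (n * Ψhigh * t ^ 2)) := by
          refine mul_le_mul ((quad_precision_le hR hQ hE hΛ0 hΨ hS hΨ' z).trans ?_)
            ((quad_precision_le hR hQ hE hΛ0 hΨ hS hΨ' e).trans ?_) (quad_nonneg hQ e)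
            (by positivity) <;> gcongr
      _ = (Λhigh / Ψlow) ^ 2 * t ^ 2 * ((n * δ ^ 2) * (n * Ψhigh)) := by ring
      _ ≤ (Λhigh / Ψlow) ^ 2 * t ^ 2 * Ψlow ^ 2 := by gcongr
      _ = Λhigh ^ 2 * t ^ 2 * 1 := by field_simp
      _ ≤ Λhigh ^ 2 * t ^ 2 * t ^ 2 := by gcongr; exact one_le_pow₀ ht
      _ = (l ^ 2) ^ 2 := by rw [hl2]; ring
  have hzl : √(quad Q z) ≤ l := by
    refine Real.sqrt_le_iff.2 ⟨hl0, hzQ.trans ?_⟩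
    rw [hl2]
    exact le_mul_of_one_le_right hΛ0 (one_le_pow₀ ht)
  have hkl : √(quad Q k) ≤ a + l := by
    have : k = h + -z := by rw [hz]; abel
    rw [this]
    refine (sqrt_quad_add_le hQ _ _).trans ?_
    rw [quad_neg]
    exact add_le_add_right hzl a
  have hke : k ⬝ᵥ (Q *ᵥ e) ≤ l * (a + l) := by
    have h1 : k ⬝ᵥ (Q *ᵥ e) = (Q *ᵥ k) ⬝ᵥ e := by
      rw [dotProduct_mulVec_comm_of_isHermitian hQ.1, dotProduct_comm]
    rw [h1]
    refine hk.trans ?_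
    have h2 : √(quad Sig (Q *ᵥ k)) ≤ √Λhigh * √(quad Q k) := by
      rw [← Real.sqrt_mul hΛ0]
      exact Real.sqrt_le_sqrt (quad_cov_mulVec_le hR hQ hE hΛ0 k)
    calc t * √(quad Sig (Q *ᵥ k)) ≤ t * (√Λhigh * (a + l)) := by
          gcongr
          exact h2.trans (by gcongr)
      _ = l * (a + l) := by rw [hl]; ring
  have hbasic : a ^ 2 ≤ 2 * (h ⬝ᵥ (Q *ᵥ e)) - 2 * (h ⬝ᵥ (Q *ᵥ p)) := by
    have h1 := quad_add hQ.1 (-h) (e - p)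
    rw [show -h + (e - p) = e - p - h by abel, quad_neg, neg_dotProduct, mulVec_sub,
      dotProduct_sub] at h1
    rw [ha2]
    linarith
  have hhp := (abs_le.1 (abs_dotProduct_mulVec_le hQ h p)).1
  have hsplit : h ⬝ᵥ (Q *ᵥ e) = k ⬝ᵥ (Q *ᵥ e) + z ⬝ᵥ (Q *ᵥ e) := by
    rw [← add_dotProduct, hz]; congr 1; abel
  have hze' := (abs_le.1 hze).2
  have hmain : a ^ 2 ≤ 2 * (l * (a + l)) + 2 * l ^ 2 + 2 * (a * q) := by
    change -(a * q) ≤ _ at hhp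
    linarith
  -- `hmain` reads `a² ≤ 2la + 4l² + 2aq`, which fails once `a > 4l + 2q`.
  by_contra hc
  push Not at hc
  nlinarith

end Discrepancy


/-! ### Choice of the net and the convergence rate -/

section Rate

/-- The mesh is `n⁻⁵`, with `n ^ 7` levels and outer-weight grid parameter `n ^ 6`. The exponent is
`9d + 34 = 8 · 2 + 9 (d + 2)`, using `r + 1 ≤ 2r`. -/
lemma exists_sieve_net {d n r : ℕ} {σ : ℝ → ℝ} {b V M : ℝ} (hm : Monotone σ)
    (hc : Continuous σ) (hb : ∀ t, σ t ∈ Set.Icc (-b) b) (X : Fin n → Cov d) (hn : 3 ≤ n)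
    (hr : 1 ≤ r) (hrn : r ≤ n) (hbn : 2 * b < n) (hVn : V ≤ n) :
    ∃ T : Finset (Fin n → ℝ), T.card ≤ n ^ ((9 * d + 34) * r) ∧
      ∀ f ∈ sieve d σ r V M, ∃ v ∈ T, ∀ i, |f (X i) - v i| ≤ 3 / (n : ℝ) ^ 3 := by
  have hn0 : (0 : ℝ) < n := by exact_mod_cast (by omega : 0 < n)
  have hn1 : (1 : ℝ) ≤ n := by exact_mod_cast (by omega : 1 ≤ n)
  have hb0 : 0 ≤ b := by linarith [(hb 0).1.trans (hb 0).2]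
  have hδ : (0 : ℝ) < 1 / (n : ℝ) ^ 5 := by positivity
  obtain ⟨T, hT, hcov⟩ := exists_sieve_cover (r := r) (M := M) (V := V) hm hc hb hδ X
    (n ^ 7) (n ^ 6)
    (by
      have : ((n ^ 7 : ℕ) : ℝ) * (1 / (n : ℝ) ^ 5) = (n : ℝ) ^ 2 := by push_cast; field_simp
      rw [this]; nlinarith)
    (by
      have : ((n ^ 6 : ℕ) : ℝ) * (1 / (n : ℝ) ^ 5) = (n : ℝ) := by push_cast; field_simp
      rwa [this])
  refine ⟨T, hT.trans ?_, fun f hf => ?_⟩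
  · have h6 : 1 ≤ n ^ 6 := Nat.one_le_pow _ _ (by omega)
    have h8 : 1 ≤ n ^ 8 := Nat.one_le_pow _ _ (by omega)
    have hA : 2 * n ^ 6 + 3 ≤ n ^ 8 := by
      have : n ^ 8 = n ^ 6 * n ^ 2 := by ring
      have h9 : 9 ≤ n ^ 2 := by nlinarith
      rw [this]; nlinarith [Nat.mul_le_mul_left (n ^ 6) h9]
    have hB : n * n ^ 7 + 1 ≤ n ^ 9 := by
      have h1 : n * n ^ 7 = n ^ 8 := by ring
      have h2 : n ^ 9 = n ^ 8 * n := by ring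
      rw [h1, h2]; nlinarith
    calc (2 * n ^ 6 + 3) ^ (r + 1) * ((n * n ^ 7 + 1) ^ (d + 2)) ^ r
        ≤ (n ^ 8) ^ (2 * r) * ((n ^ 9) ^ (d + 2)) ^ r := by
          refine Nat.mul_le_mul ((Nat.pow_le_pow_left hA _).trans
            (Nat.pow_le_pow_right h8 (by omega))) ?_
          gcongr
      _ = n ^ ((9 * d + 34) * r) := by
          rw [← pow_mul, ← pow_mul, ← pow_mul, ← pow_add]; congr 1; ring
  · obtain ⟨v, hv, h⟩ := hcov f hf
    refine ⟨v, hv, fun i => (h i).trans ?_⟩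
    have hrn' : (r : ℝ) ≤ n := by exact_mod_cast hrn
    have hrb : (r : ℝ) * b ≤ n * n := by
      refine mul_le_mul hrn' ?_ hb0 hn0.le
      linarith
    have h3 : 1 + r * b + V ≤ 3 * (n : ℝ) ^ 2 := by nlinarith
    calc 1 / (n : ℝ) ^ 5 * (1 + r * b + V) ≤ 1 / (n : ℝ) ^ 5 * (3 * (n : ℝ) ^ 2) := by gcongr
      _ = 3 / (n : ℝ) ^ 3 := by field_simp

lemma empNorm_eq {d n : ℕ} (X : Fin n → Cov d) (f : Cov d → ℝ) :
    empNorm X f = √((fun i => f (X i)) ⬝ᵥ fun i => f (X i)) / √n := by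
  rw [empNorm, ← Real.sqrt_div (dotProduct_self_nonneg_real _)]
  congr 1
  simp only [dotProduct, sq]
  ring

lemma exp_neg_sq_div_two {k : ℝ} (hk : 0 ≤ k) :
    Real.exp (-√(4 * k) ^ 2 / 2) = Real.exp (-(2 * k)) := by
  rw [Real.sq_sqrt (by linarith)]; congr 1; ring

/-- The constant of the rate. -/
noncomputable def rateConst (d : ℕ) (Ψlow Ψhigh : ℝ) : ℝ :=
  8 * √((9 * d + 35) * Ψhigh) + 2 * √(Ψhigh / Ψlow) + 1

lemma rateConst_pos (d : ℕ) (Ψlow Ψhigh : ℝ) : 0 < rateConst d Ψlow Ψhigh := by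
  unfold rateConst; positivity

/-- From a bound in the norm of the precision matrix to the bound in the empirical norm. -/
lemma empNorm_le_of_sqrt_quad_le {d n : ℕ} {Sig R Q : Matrix (Fin n) (Fin n) ℝ}
    {Λlow Λhigh Ψlow Ψhigh κ : ℝ} (hR : R * Rᵀ = Sig) (hQ : Q.PosDef)
    (hE : ∀ μ ∈ spectrum ℝ (Rᵀ * Q * R), Λlow ≤ μ ∧ μ ≤ Λhigh) (hΛl : 0 < Λlow)
    (hΛl1 : Λlow ≤ 1) (hΛ : 1 ≤ Λhigh) (hΨ : 0 < Ψlow)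
    (hS : ∀ μ ∈ spectrum ℝ Sig, Ψlow ≤ μ ∧ μ ≤ Ψhigh) (hΨ' : 0 ≤ Ψhigh)
    (X : Fin n → Cov d) (f p f₀ : Cov d → ℝ) (hκ : 0 ≤ κ)
    (h : √(quad Q fun i => f (X i) - p (X i)) ≤ 4 * (√Λhigh * √(4 * ((9 * d + 35) * κ)))
      + 2 * √(quad Q fun i => p (X i) - f₀ (X i))) :
    empNorm X (fun x => f x - f₀ x) ≤ rateConst d Ψlow Ψhigh *
      max ((Λhigh / Λlow) * empNorm X (fun x => p x - f₀ x)) ((Λhigh / Λlow) * √(κ / n)) := by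
  have hΛ0 : 0 ≤ Λhigh := by linarith
  set hv : Fin n → ℝ := fun i => f (X i) - p (X i) with hhv
  set pv : Fin n → ℝ := fun i => p (X i) - f₀ (X i) with hpv
  set ρ := Λhigh / Λlow with hρ
  have hρ1 : 1 ≤ ρ := by rw [hρ, one_le_div hΛl]; linarith
  have hρ0 : 0 ≤ ρ := by linarith
  -- The argument produces `√ρ`; since `ρ ≥ 1` it may be replaced by the `ρ` of the stated rate.
  have hsρ : √ρ ≤ ρ := by
    rw [Real.sqrt_le_iff]; exact ⟨hρ0, by nlinarith⟩
  set np := √(pv ⬝ᵥ pv)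
  have hnp : 0 ≤ np := Real.sqrt_nonneg _
  have h1 : √(hv ⬝ᵥ hv) ≤ √(Ψhigh / Λlow) * √(quad Q hv) := by
    rw [← Real.sqrt_mul (by positivity)]
    exact Real.sqrt_le_sqrt
      (dotProduct_self_le_quad hR hQ (fun μ hμ => (hE μ hμ).1) hΛl hΨ hS hΨ' hv)
  have h2 : √(quad Q pv) ≤ √(Λhigh / Ψlow) * np := by
    rw [← Real.sqrt_mul (by positivity)]
    exact Real.sqrt_le_sqrt (quad_precision_le hR hQ (fun μ hμ => (hE μ hμ).2) hΛ0 hΨ hS hΨ' pv)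
  have hA : √(Ψhigh / Λlow) * (4 * (√Λhigh * √(4 * ((9 * d + 35) * κ))))
      = 8 * √((9 * d + 35) * Ψhigh) * (√ρ * √κ) := by
    have h4 : √(4 : ℝ) = 2 := by
      rw [show (4 : ℝ) = 2 ^ 2 by norm_num]; exact Real.sqrt_sq (by norm_num)
    rw [Real.sqrt_mul (by norm_num : (0 : ℝ) ≤ 4), h4, Real.sqrt_mul (by positivity) κ,
      Real.sqrt_mul (by positivity) Ψhigh, hρ, Real.sqrt_div hΨ', Real.sqrt_div hΛ0]
    ring
  have hB : √(Ψhigh / Λlow) * (2 * (√(Λhigh / Ψlow) * np)) = 2 * √(Ψhigh / Ψlow) * (√ρ * np) := by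
    rw [hρ, Real.sqrt_div hΨ', Real.sqrt_div hΛ0, Real.sqrt_div hΨ', Real.sqrt_div hΛ0]
    ring
  have h3 : √(hv ⬝ᵥ hv) ≤ 8 * √((9 * d + 35) * Ψhigh) * (ρ * √κ)
      + 2 * √(Ψhigh / Ψlow) * (ρ * np) := by
    calc √(hv ⬝ᵥ hv) ≤ √(Ψhigh / Λlow) * (4 * (√Λhigh * √(4 * ((9 * d + 35) * κ)))
          + 2 * (√(Λhigh / Ψlow) * np)) := h1.trans (by gcongr; exact h.trans (by gcongr))
      _ = 8 * √((9 * d + 35) * Ψhigh) * (√ρ * √κ) + 2 * √(Ψhigh / Ψlow) * (√ρ * np) := by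
          rw [mul_add, hA, hB]
      _ ≤ _ := by gcongr
  have h4 : √((fun i => f (X i) - f₀ (X i)) ⬝ᵥ fun i => f (X i) - f₀ (X i))
      ≤ √(hv ⬝ᵥ hv) + np := by
    have := sqrt_quad_add_le (PosDef.one (n := Fin n) (R := ℝ)) hv pv
    rw [quad_one, quad_one, quad_one] at this
    have hsum : hv + pv = fun i => f (X i) - f₀ (X i) := by
      funext i; simp [hhv, hpv]
    rwa [hsum] at this
  rw [empNorm_eq, empNorm_eq]
  set m := max (ρ * (np / √n)) (ρ * √(κ / n)) with hm
  have hm1 : ρ * (np / √n) ≤ m := le_max_left _ _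
  have hm2 : ρ * √κ / √n ≤ m := by
    rw [mul_div_assoc, ← Real.sqrt_div hκ]; exact le_max_right _ _
  have hm3 : np / √n ≤ m := le_trans (le_mul_of_one_le_left (by positivity) hρ1) hm1
  calc √((fun i => f (X i) - f₀ (X i)) ⬝ᵥ fun i => f (X i) - f₀ (X i)) / √n
      ≤ (8 * √((9 * d + 35) * Ψhigh) * (ρ * √κ)
          + 2 * √(Ψhigh / Ψlow) * (ρ * np) + np) / √n := by gcongr; linarith
    _ = 8 * √((9 * d + 35) * Ψhigh) * (ρ * √κ / √n)
          + 2 * √(Ψhigh / Ψlow) * (ρ * (np / √n)) + np / √n := by ring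
    _ ≤ 8 * √((9 * d + 35) * Ψhigh) * m + 2 * √(Ψhigh / Ψlow) * m + m := by gcongr
    _ = rateConst d Ψlow Ψhigh * m := by rw [rateConst]; ring

/-- The error bound at a fixed, sufficiently large sample size. -/
lemma measure_rate_lt_le {d n r : ℕ} {Ω S : Type*} [MeasurableSpace Ω] {P : Measure Ω}
    {ε : S → Ω → ℝ} (hε : IsGaussianProcess ε P) (h0 : ∀ t, ∫ ω, ε t ω ∂P = 0)
    {f₀ : Cov d → ℝ} {X : Fin n → Cov d} {s : Fin n → S} {R Q : Matrix (Fin n) (Fin n) ℝ}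
    {Λlow Λhigh Ψlow Ψhigh η : ℝ}
    (hR : R * Rᵀ = covMatrix P (response f₀ X ε s)) (hQ : Q.PosDef)
    (hE : ∀ μ ∈ spectrum ℝ (Rᵀ * Q * R), Λlow ≤ μ ∧ μ ≤ Λhigh) (hΛl : 0 < Λlow)
    (hΛl1 : Λlow ≤ 1) (hΛ : 1 ≤ Λhigh) (hΨ : 0 < Ψlow)
    (hS : ∀ μ ∈ spectrum ℝ (covMatrix P (response f₀ X ε s)), Ψlow ≤ μ ∧ μ ≤ Ψhigh)
    (hΨ' : 0 ≤ Ψhigh) {σ : ℝ → ℝ} {b V M : ℝ} (hm : Monotone σ)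
    (hc : Continuous σ) (hb : ∀ t, σ t ∈ Set.Icc (-b) b) (hn : 3 ≤ n)
    (hr : 1 ≤ r) (hrn : r ≤ n) (hbn : 2 * b < n) (hVn : V ≤ n)
    (hn1 : 9 ≤ Ψlow * n) (hn2 : 9 * Ψhigh ≤ Ψlow ^ 2 * n) (hn3 : 1 ≤ η * n)
    {fhat : Ω → Cov d → ℝ} {proj : Cov d → ℝ}
    (hfhat : ∀ᵐ ω ∂P, IsGLSEstimate X Q (fun i => response f₀ X ε s i ω) (sieve d σ r V M)
      (fhat ω)) (hproj : proj ∈ sieve d σ r V M) :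
    P {ω | rateConst d Ψlow Ψhigh * max
          ((Λhigh / Λlow) * empNorm X (fun x => proj x - f₀ x))
          ((Λhigh / Λlow) * √((r : ℝ) * Real.log n / n))
        < empNorm X (fun x => fhat ω x - f₀ x)} ≤ ENNReal.ofReal η := by
  classical
  have hnR3 : (3 : ℝ) ≤ n := by exact_mod_cast hn
  have hn0 : (0 : ℝ) < n := by linarith
  have hlog : 1 ≤ Real.log n := by
    rw [Real.le_log_iff_exp_le hn0]
    linarith [Real.exp_one_lt_d9]
  have hr' : (1 : ℝ) ≤ r := by exact_mod_cast hr
  set κ := (r : ℝ) * Real.log n with hκ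
  have hκ1 : 1 ≤ κ := by nlinarith
  -- With this `t`, `exp (-t² / 2) = k⁻²` for `k = n ^ ((9d + 35) r)`. As `k` bounds the number of
  -- directions, the failure probability is at most `1 / k ≤ 1 / n`.
  set t := √(4 * ((9 * d + 35) * κ)) with ht
  have ht1 : 1 ≤ t := by
    rw [ht, Real.one_le_sqrt]
    have : (0 : ℝ) ≤ d := Nat.cast_nonneg d
    nlinarith
  obtain ⟨T, hTc, hT⟩ := exists_sieve_net (M := M) hm hc hb X hn hr hrn hbn hVn
  set Sig := covMatrix P (response f₀ X ε s) with hSig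
  -- Besides the net directions, `W` contains the signed unit vectors, which bound every `|ε (s i)
  -- ω|` by `t * √Ψhigh` on the same event.
  let W : Finset (Fin n → ℝ) := T.image (fun v => Q *ᵥ (v - fun i => proj (X i))) ∪
    (Finset.univ.image (fun i : Fin n => (Pi.single i 1 : Fin n → ℝ)) ∪
      Finset.univ.image fun i : Fin n => -(Pi.single i 1 : Fin n → ℝ))
  have hWc : W.card ≤ n ^ ((9 * d + 35) * r) := by
    have h1 : W.card ≤ T.card + (n + n) := by
      refine (Finset.card_union_le _ _).trans (Nat.add_le_add Finset.card_image_le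
        ((Finset.card_union_le _ _).trans (Nat.add_le_add ?_ ?_)))
      · exact Finset.card_image_le.trans (by simp)
      · exact Finset.card_image_le.trans (by simp)
    have h2 : n ≤ n ^ ((9 * d + 34) * r) :=
      Nat.le_self_pow (by positivity) n
    have h3 : n ≤ n ^ r := Nat.le_self_pow (by omega) n
    calc W.card ≤ n ^ ((9 * d + 34) * r) * 3 := by omega
      _ ≤ n ^ ((9 * d + 34) * r) * n ^ r := Nat.mul_le_mul_left _ (hn.trans h3)
      _ = n ^ ((9 * d + 35) * r) := by rw [← pow_add]; congr 1; ring
  have hprob : (W.card : ℝ) * Real.exp (-t ^ 2 / 2) ≤ η := by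
    have hexp : Real.exp ((9 * d + 35) * κ) = (n : ℝ) ^ ((9 * d + 35) * r) := by
      rw [← Real.exp_log (pow_pos hn0 _), Real.log_pow, hκ]
      push_cast
      congr 1; ring
    set k := (n : ℝ) ^ ((9 * d + 35) * r) with hk
    have hk0 : 0 < k := by positivity
    have hnk : (n : ℝ) ≤ k := by
      rw [hk]; exact_mod_cast Nat.le_self_pow (by positivity) n
    have hW' : (W.card : ℝ) ≤ k := by rw [hk]; exact_mod_cast hWc
    rw [ht, exp_neg_sq_div_two (by positivity), Real.exp_neg, two_mul, Real.exp_add, hexp]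
    calc (W.card : ℝ) * (k * k)⁻¹ ≤ k * (k * k)⁻¹ := by gcongr
      _ = 1 / k := by field_simp
      _ ≤ 1 / n := by gcongr
      _ ≤ η := by rw [div_le_iff₀ hn0]; exact hn3
  have hbad := measure_exists_lt_dotProduct_le hε h0 f₀ X s W (zero_le_one.trans ht1)
  refine le_trans (measure_mono_ae ?_) (hbad.trans (ENNReal.ofReal_le_ofReal hprob))
  filter_upwards [hfhat] with ω hω hlt
  change ∃ w ∈ W, _
  by_contra hgood
  push Not at hgood
  refine absurd hlt (not_lt.2 (empNorm_le_of_sqrt_quad_le hR hQ hE hΛl hΛl1 hΛ hΨ hS hΨ' X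
    (fhat ω) proj f₀ (by linarith) ?_))
  obtain ⟨v, hvT, hv⟩ := hT _ hω.1
  have hSH : Sig.IsHermitian := by
    rw [← hR, ← conjTranspose_eq_transpose_of_trivial]
    exact isHermitian_mul_conjTranspose_self R
  have hdiag : ∀ i : Fin n, √(quad Sig (Pi.single i 1)) ≤ √Ψhigh := fun i =>
    Real.sqrt_le_sqrt (by
      simpa using quad_le_of_spectrum hSH (fun μ hμ => (hS μ hμ).2) (Pi.single i 1))
  refine sqrt_quad_le_of_basic_inequality (k := v - fun i => proj (X i))
    (e := fun i => ε (s i) ω) (δ := 3 / (n : ℝ) ^ 3) hR hQ (fun μ hμ => (hE μ hμ).2) hΛ hΨ hS hΨ'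
    ht1 ?_ ?_ ?_ ?_ ?_ ?_
  · have h1 := hω.2 proj hproj
    simp only [glsLoss, response] at h1
    have h2 := le_of_mul_le_mul_left h1 (by positivity)
    have hg : ∀ g : Cov d → ℝ, (fun i => f₀ (X i) + ε (s i) ω - g (X i))
        = (fun i => ε (s i) ω) - (fun i => proj (X i) - f₀ (X i))
          - fun i => g (X i) - proj (X i) := by
      intro g; funext i; simp only [Pi.sub_apply]; ring
    have hz : (fun i => proj (X i) - proj (X i)) = (0 : Fin n → ℝ) := by funext i; simp
    rw [hg, hg proj, hz, sub_zero] at h2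
    exact h2
  · exact hgood _ (Finset.mem_union_left _ (Finset.mem_image_of_mem _ hvT))
  · intro i
    have h1 := hgood _ (Finset.mem_union_right _ (Finset.mem_union_left _
      (Finset.mem_image_of_mem _ (Finset.mem_univ i))))
    have h2 := hgood _ (Finset.mem_union_right _ (Finset.mem_union_right _
      (Finset.mem_image_of_mem _ (Finset.mem_univ i))))
    change _ ≤ t * √(quad Sig _) at h1
    change _ ≤ t * √(quad Sig _) at h2
    rw [quad_neg, neg_dotProduct] at h2
    rw [single_one_dotProduct] at h1 h2
    have h3 : t * √(quad Sig (Pi.single i 1)) ≤ t * √Ψhigh :=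
      mul_le_mul_of_nonneg_left (hdiag i) (by linarith)
    rw [abs_le]
    constructor <;> linarith
  · intro i
    simpa using hv i
  · have : (n : ℝ) * (3 / (n : ℝ) ^ 3) ^ 2 = 9 / (n : ℝ) ^ 5 := by field_simp; norm_num
    rw [this, div_le_iff₀ (by positivity)]
    refine hn1.trans (mul_le_mul_of_nonneg_left ?_ hΨ.le)
    exact le_self_pow₀ (by linarith) (by norm_num)
  · have : (n : ℝ) * (3 / (n : ℝ) ^ 3) ^ 2 * (n * Ψhigh) = 9 * Ψhigh / (n : ℝ) ^ 4 := by
      field_simp; ring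
    rw [this, div_le_iff₀ (by positivity)]
    refine hn2.trans (mul_le_mul_of_nonneg_left ?_ (sq_nonneg _))
    exact le_self_pow₀ (by linarith) (by norm_num)

/-- Under the growth condition the number of neurons and the bound for the outer weights are
eventually at most the sample size. -/
lemma SieveGrowth.eventually_le {σ : ℝ → ℝ} {b : ℝ} {L : ℝ≥0} {r : ℕ → ℕ} {V M : ℕ → ℝ}
    (h : SieveGrowth σ b L r V M) : ∀ᶠ n in atTop, 1 ≤ r n ∧ r n ≤ n ∧ V n ≤ n := by
  have hb := h.scaling.bound zero_lt_one
  filter_upwards [hb, h.r_tendsto.eventually_ge_atTop 3, h.V_tendsto.eventually_ge_atTop 1]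
    with n hn hr hV
  have hr' : (3 : ℝ) ≤ r n := by exact_mod_cast hr
  -- Since `V n * r n ≥ 3 > e`, the logarithm can be dropped from the growth condition, leaving `r n
  -- * V n ^ 2 ≤ n`.
  have hlog : 1 ≤ Real.log (V n * r n) := by
    rw [Real.le_log_iff_exp_le (by positivity)]
    nlinarith [Real.exp_one_lt_d9]
  have hV2 : V n ≤ V n ^ 2 := by nlinarith
  rw [one_mul, Real.norm_natCast] at hn
  have hn' := (le_abs_self _).trans hn
  have h1 : (r n : ℝ) * V n ^ 2 ≤ n := by
    refine le_trans ?_ hn'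
    exact le_mul_of_one_le_right (by positivity) hlog
  refine ⟨by omega, ?_, ?_⟩
  · have : (r n : ℝ) ≤ n := by nlinarith
    exact_mod_cast this
  · nlinarith

end Rate

end NNGLS

theorem theorem3 (d : ℕ) (Ψlow Ψhigh : ℝ) (hΨ : 0 < Ψlow) (η : ℝ) (hη : 0 < η) :
    -- the constant depends only on `d`, `Ψlow`, `Ψhigh` and the probability level `η`
    ∃ C : ℝ, 0 < C ∧
      ∀ {Ω : Type*} [MeasurableSpace Ω] (P : Measure Ω) [IsProbabilityMeasure P] {S : Type*}
        (f₀ : NNGLS.Cov d → ℝ) (K : Set (NNGLS.Cov d)) (X : (n : ℕ) → Fin n → NNGLS.Cov d)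
        (ε : S → Ω → ℝ) (s : (n : ℕ) → Fin n → S)
        (σ : ℝ → ℝ) (b : ℝ) (L : ℝ≥0) (r : ℕ → ℕ) (V M : ℕ → ℝ)
        (Λlow Λhigh : ℝ) (R Q : (n : ℕ) → Matrix (Fin n) (Fin n) ℝ)
        (fhat : (n : ℕ) → Ω → NNGLS.Cov d → ℝ) (proj : (n : ℕ) → NNGLS.Cov d → ℝ),
        NNGLS.DataGeneration P Ψlow Ψhigh f₀ K X ε s →
        NNGLS.SieveGrowth σ b L r V M →
        NNGLS.SpectralInterval Λlow Λhigh
          (fun n => NNGLS.covMatrix P (NNGLS.response f₀ (X n) ε (s n))) R Q →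
        (∀ n, ∀ᵐ ω ∂P, NNGLS.IsGLSEstimate (X n) (Q n)
          (fun i => NNGLS.response f₀ (X n) ε (s n) i ω)
          (NNGLS.sieve d σ (r n) (V n) (M n)) (fhat n ω)) →
        (∀ n, NNGLS.IsProjection (X n) (NNGLS.sieve d σ (r n) (V n) (M n)) f₀ (proj n)) →
        ∃ N : ℕ, ∀ n ≥ N,
          P {ω | C * max
                  ((Λhigh / Λlow) * NNGLS.empNorm (X n) (fun x => proj n x - f₀ x))
                  ((Λhigh / Λlow) * √((r n : ℝ) * Real.log n / n))
                < NNGLS.empNorm (X n) (fun x => fhat n ω x - f₀ x)}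
            ≤ ENNReal.ofReal η := by
  -- The failure probability is at most `1 / n`, so `η` affects only `N`, not the constant.
  refine ⟨NNGLS.rateConst d Ψlow Ψhigh, NNGLS.rateConst_pos _ _ _, ?_⟩
  intro Ω _ P _ S f₀ K X ε s σ b L r V M Λlow Λhigh R Q fhat proj hD hG hE hfhat hproj
  have hlarge : ∀ a c : ℝ, 0 < c → ∀ᶠ n : ℕ in atTop, a ≤ c * n := fun a c hc =>
    (tendsto_natCast_atTop_atTop.const_mul_atTop hc).eventually_ge_atTop a
  refine eventually_atTop.1 ?_
  filter_upwards [hG.eventually_le, eventually_ge_atTop 3,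
    tendsto_natCast_atTop_atTop.eventually_gt_atTop (2 * b), hlarge 9 Ψlow hΨ,
    hlarge (9 * Ψhigh) (Ψlow ^ 2) (by positivity), hlarge 1 η hη]
    with n ⟨hr, hrn, hVn⟩ hn hbn hn1 hn2 hn3
  -- For `n ≥ 1` the covariance matrix has an eigenvalue, which lies between `Ψlow > 0` and `Ψhigh`.
  have hΨ' : 0 ≤ Ψhigh := by
    have hSH : (NNGLS.covMatrix P (NNGLS.response f₀ (X n) ε (s n))).IsHermitian := by
      rw [← hE.sqrt_cov n, ← conjTranspose_eq_transpose_of_trivial]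
      exact isHermitian_mul_conjTranspose_self (R n)
    have := hD.spectrum_cov n _ (hSH.eigenvalues_mem_spectrum_real ⟨0, by omega⟩)
    linarith [this.1, this.2]
  exact NNGLS.measure_rate_lt_le hD.gaussian hD.centered (hE.sqrt_cov n) (hE.precision n)
    (hE.spectrum_discrepancy n) hE.low_pos hE.low_le_one hE.one_le_high hΨ (hD.spectrum_cov n) hΨ'
    hG.monotone hG.lipschitz.continuous hG.range_mem hn hr hrn hbn hVn hn1 hn2 hn3 (hfhat n)
    (hproj n).1
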